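/- Let $\mathcal H$ be a complex separable Hilbert space with algebra of bounded operators $\mathcal B(\mathcal H)$, and let $X$ be a set with a $\sigma$-algebra $\mathcal O(X)$ of subsets. A positive operator valued measure (POVM) on $X$ is a map $\mu:\mathcal O(X)\to\mathcal B(\mathcal H)$ such that $\mu(A)\ge 0$ for all $A\in\mathcal O(X)$ and such that $A\mapsto\langle h,\mu(A)k\rangle$ is a complex measure for all $h,k\in\mathcal H$. It is *normalized* if $\mu(X)=I_{\mathcal H}$, *commutative* if $\mu(A)\mu(B)=\mu(B)\mu(A)$ for all $A,B\in\mathcal O(X)$, and a *spectral measure* if it is normalized and every $\mu(A)$ is an orthogonal projection. A normalized POVM $\mu$ is *$C^*$-extreme* if, whenever $n\in\mathbb N$, $\mu_1,\dots,\mu_n$ are normalized POVMs on $X$ with values in $\mathcal B(\mathcal H)$ and $T_1,\dots,T_n\in\mathcal B(\mathcal H)$ are invertible with $\sum_{i=1}^n T_i^*T_i=I_{\mathcal H}$ and $\mu(A)=\sum_{i=1}^n T_i^*\mu_i(A)T_i$ for all $A\in\mathcal O(X)$, then for each $i$ there is a unitary $U_i\in\mathcal B(\mathcal H)$ with $\mu_i(A)=U_i^*\mu(A)U_i$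 for all $A\in\mathcal O(X)$. **Theorem.** Let $\mu:\mathcal O(X)\to\mathcal B(\mathcal H)$ be a commutative normalized POVM. Then $\mu$ is $C^*$-extreme if and only if it is a spectral measure. -/

import Mathlib

/-- A positive operator valued measure on the measurable space `X` with values in the bounded
operators on the Hilbert space `H`: every measurable set is sent to a positive operator, and for
all `h`, `k` the map `A ↦ ⟪h, μ(A) k⟫` is a complex measure on the measurable sets. The values on
non-measurable sets carry no meaning and are never used. -/
structure POVM (X : Type*) [MeasurableSpace X] (H : Type*) [NormedAddCommGroup H]
    [InnerProductSpace ℂ H] [CompleteSpace H] where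
  /-- The operator assigned to a set. -/
  toFun : Set X → (H →L[ℂ] H)
  isPositive : ∀ A : Set X, MeasurableSet A → (toFun A).IsPositive
  isComplexMeasure : ∀ h k : H, ∃ m : MeasureTheory.ComplexMeasure X,
    ∀ A : Set X, MeasurableSet A → m A = inner ℂ h (toFun A k)

namespace POVM

variable {X : Type*} [MeasurableSpace X] {H : Type*} [NormedAddCommGroup H]
  [InnerProductSpace ℂ H] [CompleteSpace H]

/-- `μ` is normalized: `μ(X) = I`. -/
def IsNormalized (μ : POVM X H) : Prop :=
  μ.toFun Set.univ = 1

/-- `μ` is projection valued: each `μ(A)` is an orthogonal projection. -/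
def IsPVM (μ : POVM X H) : Prop :=
  ∀ A : Set X, MeasurableSet A → IsStarProjection (μ.toFun A)

/-- `μ` is a spectral measure: projection valued and normalized. -/
def IsSpectral (μ : POVM X H) : Prop :=
  μ.IsPVM ∧ μ.IsNormalized

/-- `μ` has commutative range. -/
def IsCommutative (μ : POVM X H) : Prop :=
  ∀ A B : Set X, MeasurableSet A → MeasurableSet B → Commute (μ.toFun A) (μ.toFun B)

/-- `μ = ∑ i, T i ^* ν i (·) T i` is a `C^*`-convex combination of normalized POVMs `ν i`, with
coefficients satisfying `∑ i, T i ^* T i = I`. -/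
structure IsCStarConvexCombination (μ : POVM X H) {n : ℕ} (T : Fin n → (H →L[ℂ] H))
    (ν : Fin n → POVM X H) : Prop where
  normalized : ∀ i, (ν i).IsNormalized
  sum_coeff : ∑ i, star (T i) * T i = 1
  sum_eq : ∀ A : Set X, MeasurableSet A →
    μ.toFun A = ∑ i, star (T i) * (ν i).toFun A * T i

/-- A `C^*`-convex combination is proper if all its coefficients are invertible. -/
structure IsProperCStarConvexCombination (μ : POVM X H) {n : ℕ} (T : Fin n → (H →L[ℂ] H))
    (ν : Fin n → POVM X H) : Prop extends IsCStarConvexCombination μ T ν where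
  isUnit : ∀ i, IsUnit (T i)

/-- `ν` is unitarily equivalent to `μ`: `ν(·) = U^* μ(·) U` for some unitary `U`. -/
def UnitarilyEquivalent (ν μ : POVM X H) : Prop :=
  ∃ U ∈ unitary (H →L[ℂ] H), ∀ A : Set X, MeasurableSet A →
    ν.toFun A = star U * μ.toFun A * U

/-- `μ` is a `C^*`-extreme point of the set of normalized POVMs: it is normalized, and whenever it
is a proper `C^*`-convex combination of normalized POVMs `ν i`, each `ν i` is unitarily equivalent
to `μ`. -/
def IsCStarExtreme (μ : POVM X H) : Prop :=
  μ.IsNormalized ∧ ∀ (n : ℕ) (T : Fin n → (H →L[ℂ] H)) (ν : Fin n → POVM X H),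
    IsProperCStarConvexCombination μ T ν → ∀ i, UnitarilyEquivalent (ν i) μ

end POVM

/-! If `μ` is spectral and `μ = ∑ Tᵢ* νᵢ Tᵢ`, then `Tᵢ* νᵢ(B) Tᵢ ≤ μ(B)` vanishes under compression
to the range of `μ(Bᶜ)`. Using this for a set and its complement gives `νᵢ(A) Tᵢ = Tᵢ μ(A)`, and
polar decomposition replaces the invertible `Tᵢ` by a unitary (`mul_coeff_eq`,
`exists_unitary_of_mul_eq_mul`).

Conversely, fix `B`, let `P = μ(B)` and let `F` be the spectral projection of `P` for `P ≤ 1/2`; by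
commutativity it commutes with all of `μ`. The summand `α` of `μ` that keeps `B` on the range of `1
- F` and `Bᶜ` on that of `F` has `α(X) ≥ 1/2` and `α(B) = α(X)(1 - F)`. Normalized, it sends `B` to
`1 - F`, so extremality makes `P` unitarily equivalent to a projection. -/

namespace IsStarProjection

variable {H : Type*} [NormedAddCommGroup H] [InnerProductSpace ℂ H] [CompleteSpace H]

/-- A self-adjoint operator `T` is nonpositive on the range of a projection `F` and nonnegative on
its complement, where `F` commutes with every self-adjoint operator commuting with `T`. -/
theorem exists_mul_nonpos_of_isSelfAdjoint {T : H →L[ℂ] H} (hT : IsSelfAdjoint T) :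
    ∃ F : H →L[ℂ] H, IsStarProjection F ∧ T * F ≤ 0 ∧ 0 ≤ T * (1 - F) ∧
      ∀ Y : H →L[ℂ] H, IsSelfAdjoint Y → Commute T Y → Commute F Y := by
  set K : Submodule ℂ H := (T⁺).ker with hK
  have hKc : IsClosed (K : Set H) := (T⁺).isClosed_ker
  have : CompleteSpace K := hKc.completeSpace_coe
  have hF : IsStarProjection K.starProjection := isStarProjection_starProjection
  have hfix : ∀ Y : H →L[ℂ] H, T⁺ * Y = 0 → K.starProjection * Y = Y := by
    intro Y hY
    ext x
    refine Submodule.starProjection_eq_self_iff.2 ?_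
    exact congrArg (fun Z : H →L[ℂ] H => Z x) hY
  have hpF : T⁺ * K.starProjection = 0 := by
    ext x
    exact (Submodule.starProjection_apply_mem K x : _)
  have hnF : T⁻ * K.starProjection = T⁻ := by
    have h := congrArg star (hfix T⁻ (CFC.posPart_mul_negPart T))
    rwa [star_mul, hF.isSelfAdjoint.star_eq,
      (IsSelfAdjoint.of_nonneg (CFC.negPart_nonneg T)).star_eq] at h
  have hTF : T * K.starProjection = -T⁻ := by
    conv_lhs => rw [← CFC.posPart_sub_negPart T hT, sub_mul, hpF, hnF, zero_sub]
  refine ⟨K.starProjection, hF, ?_, ?_, ?_⟩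
  · rw [hTF]
    exact neg_nonpos.2 (CFC.negPart_nonneg T)
  · have : T * (1 - K.starProjection) = T⁺ := by
      rw [mul_sub, mul_one, hTF, sub_neg_eq_add]
      nth_rewrite 1 [← CFC.posPart_sub_negPart T hT]
      abel
    rw [this]
    exact CFC.posPart_nonneg T
  · intro Y hY hTY
    have hc : Commute T⁺ Y := hTY.cfcₙ_real _
    -- `Y` leaves `ker T⁺` invariant; being self-adjoint, it then commutes with the projection.
    have h1 : K.starProjection * (Y * K.starProjection) = Y * K.starProjection := by
      apply hfix
      rw [← mul_assoc, hc.eq, mul_assoc, hpF, mul_zero]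
    have h2 := congrArg star h1
    simp only [star_mul, hF.isSelfAdjoint.star_eq, hY.star_eq] at h2
    rw [Commute, SemiconjBy, ← h1, ← h2, mul_assoc]

end IsStarProjection

/-- An operator intertwining two families of self-adjoint operators can be replaced by a unitary,
namely the unitary part of its polar decomposition. -/
theorem exists_unitary_of_mul_eq_mul {A : Type*} [CStarAlgebra A] [PartialOrder A]
    [StarOrderedRing A] {t : A} (ht : IsUnit t) :
    ∃ u ∈ unitary A, ∀ a b : A, IsSelfAdjoint a → IsSelfAdjoint b → b * t = t * a →
      b = star u * a * u := by
  obtain ⟨t, rfl⟩ := ht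
  have hn : 0 ≤ star (t : A) * t := star_mul_self_nonneg _
  set q := CFC.sqrt (star (t : A) * t) with hq
  have hqs : star q = q := (IsSelfAdjoint.of_nonneg (CFC.sqrt_nonneg _)).star_eq
  have hqq : q * q = star (t : A) * t := CFC.sqrt_mul_sqrt_self _ hn
  have hu : IsUnit q := (CFC.isUnit_sqrt_iff _ hn).2 (t.isUnit.star.mul t.isUnit)
  have hs : star (t : A) * star (↑t⁻¹ : A) = 1 := by rw [← star_mul]; simp
  have hs' : star (↑t⁻¹ : A) * star (t : A) = 1 := by rw [← star_mul]; simp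
  -- With `t = v q` the polar decomposition, this is `v⁻¹ = v*`.
  refine ⟨q * (↑t⁻¹ : A), ?_, ?_⟩
  · rw [Unitary.mem_iff]
    constructor
    · calc star (q * (↑t⁻¹ : A)) * (q * ↑t⁻¹) = star (↑t⁻¹ : A) * (q * q) * ↑t⁻¹ := by
            rw [star_mul, hqs]; noncomm_ring
        _ = (star (↑t⁻¹ : A) * star (t : A)) * (t * ↑t⁻¹) := by rw [hqq]; noncomm_ring
        _ = 1 := by rw [hs']; simp
    · refine hu.mul_right_cancel ?_
      calc q * ↑t⁻¹ * star (q * (↑t⁻¹ : A)) * q = q * ↑t⁻¹ * star (↑t⁻¹ : A) * (q * q) := by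
            rw [star_mul, hqs]; noncomm_ring
        _ = q * ↑t⁻¹ * (star (↑t⁻¹ : A) * star (t : A)) * t := by rw [hqq]; noncomm_ring
        _ = 1 * q := by rw [hs']; simp [mul_assoc]
  · intro a b ha hb hab
    have hab' : star (t : A) * b = a * star (t : A) := by
      simpa [ha.star_eq, hb.star_eq] using congrArg star hab
    have hc : Commute (star (t : A) * t) a := by
      rw [Commute, SemiconjBy, mul_assoc, ← hab, ← mul_assoc, hab', mul_assoc]
    have hqa : q * a = a * q := by
      rw [hq, CFC.sqrt_eq_cfc]
      exact hc.cfc_nnreal _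
    calc b = star (↑t⁻¹ : A) * (star (t : A) * b) := by rw [← mul_assoc, hs', one_mul]
      _ = star (↑t⁻¹ : A) * (a * (star (t : A) * t)) * ↑t⁻¹ := by rw [hab']; simp [mul_assoc]
      _ = star (↑t⁻¹ : A) * (q * a * q) * ↑t⁻¹ := by rw [← hqq, hqa]; noncomm_ring
      _ = star (q * (↑t⁻¹ : A)) * a * (q * ↑t⁻¹) := by rw [star_mul, hqs]; noncomm_ring

/-- If `a ≤ e` and `c e c = 0`, where `a = s* b s`, then `b s c = 0`. -/
theorem mul_mul_eq_zero_of_conj_le {A : Type*} [CStarAlgebra A] [PartialOrder A]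
    [StarOrderedRing A] {b c e s : A} (hb : 0 ≤ b) (hle : star s * b * s ≤ e)
    (hc : star c * e * c = 0) : b * s * c = 0 := by
  set q := CFC.sqrt b with hq
  have hqs : star q = q := (IsSelfAdjoint.of_nonneg (CFC.sqrt_nonneg _)).star_eq
  have hqq : q * q = b := CFC.sqrt_mul_sqrt_self _ hb
  have h1 : star (q * s * c) * (q * s * c) ≤ 0 := by
    calc star (q * s * c) * (q * s * c) = star c * (star s * (q * q) * s) * c := by
          rw [star_mul, star_mul, hqs]; noncomm_ring
      _ ≤ star c * e * c := by rw [hqq]; exact star_left_conjugate_le_conjugate hle c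
      _ = 0 := hc
  have h2 : q * s * c = 0 :=
    (CStarRing.star_mul_self_eq_zero_iff _).1 (le_antisymm h1 (star_mul_self_nonneg _))
  rw [← hqq, mul_assoc, mul_assoc, ← mul_assoc q s c, h2, mul_zero]

theorem isUnit_of_one_le_nsmul {A : Type*} [CStarAlgebra A] [PartialOrder A]
    [StarOrderedRing A] (n : ℕ) {a : A} (h : 1 ≤ n • a) : IsUnit a := by
  rw [nsmul_eq_mul] at h
  exact ((Nat.cast_commute n a).isUnit_mul_iff.1 (CStarAlgebra.isUnit_of_le 1 h)).2

/-! ### Operations on POVMs. -/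

namespace POVM

variable {X : Type*} [MeasurableSpace X] {H : Type*} [NormedAddCommGroup H]
  [InnerProductSpace ℂ H] [CompleteSpace H]

theorem isSelfAdjoint (μ : POVM X H) {A : Set X} (hA : MeasurableSet A) :
    IsSelfAdjoint (μ.toFun A) :=
  (μ.isPositive A hA).isSelfAdjoint

theorem nonneg (μ : POVM X H) {A : Set X} (hA : MeasurableSet A) : 0 ≤ μ.toFun A :=
  (ContinuousLinearMap.nonneg_iff_isPositive _).2 (μ.isPositive A hA)

theorem toFun_empty (μ : POVM X H) : μ.toFun ∅ = 0 := by
  refine ContinuousLinearMap.ext fun k => ext_inner_left ℂ fun h => ?_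
  obtain ⟨m, hm⟩ := μ.isComplexMeasure h k
  rw [← hm _ MeasurableSet.empty]
  simp

theorem toFun_add_compl (μ : POVM X H) {A : Set X} (hA : MeasurableSet A) :
    μ.toFun A + μ.toFun Aᶜ = μ.toFun Set.univ := by
  refine ContinuousLinearMap.ext fun k => ext_inner_left ℂ fun h => ?_
  obtain ⟨m, hm⟩ := μ.isComplexMeasure h k
  rw [add_apply, inner_add_right, ← hm _ hA, ← hm _ hA.compl,
    ← hm _ MeasurableSet.univ, m.of_add_of_sdiff hA MeasurableSet.univ (Set.subset_univ A) |>.symm,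
    Set.compl_eq_univ_sdiff]

/-- The restriction `A ↦ μ(A ∩ B)` of `μ` to the measurable set `B`. -/
def restrict (μ : POVM X H) (B : Set X) (hB : MeasurableSet B) : POVM X H where
  toFun A := μ.toFun (A ∩ B)
  isPositive A hA := μ.isPositive _ (hA.inter hB)
  isComplexMeasure h k := by
    obtain ⟨m, hm⟩ := μ.isComplexMeasure h k
    exact ⟨m.restrict B, fun A hA => by
      rw [MeasureTheory.VectorMeasure.restrict_apply _ hB hA, hm _ (hA.inter hB)]⟩

theorem toFun_restrict_add_restrict_compl (μ : POVM X H) {A B : Set X} (hA : MeasurableSet A)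
    (hB : MeasurableSet B) :
    (μ.restrict B hB).toFun A + (μ.restrict Bᶜ hB.compl).toFun A = μ.toFun A := by
  have h := (μ.restrict A hA).toFun_add_compl hB
  simpa [restrict, Set.inter_comm] using h

/-- The conjugation `A ↦ S* μ(A) S` of `μ` by `S`. -/
noncomputable def conj (μ : POVM X H) (S : H →L[ℂ] H) : POVM X H where
  toFun A := star S * μ.toFun A * S
  isPositive A hA := by
    rw [← ContinuousLinearMap.nonneg_iff_isPositive]
    exact star_left_conjugate_nonneg (μ.nonneg hA) S
  isComplexMeasure h k := by
    obtain ⟨m, hm⟩ := μ.isComplexMeasure (S h) (S k)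
    exact ⟨m, fun A hA => by
      rw [hm A hA, ContinuousLinearMap.star_eq_adjoint]
      simp [ContinuousLinearMap.adjoint_inner_right]⟩

instance : Add (POVM X H) where
  add μ ν :=
    { toFun A := μ.toFun A + ν.toFun A
      isPositive A hA := (μ.isPositive A hA).add (ν.isPositive A hA)
      isComplexMeasure h k := by
        obtain ⟨m, hm⟩ := μ.isComplexMeasure h k
        obtain ⟨n, hn⟩ := ν.isComplexMeasure h k
        exact ⟨m + n, fun A hA => by simp [hm A hA, hn A hA]⟩ }

theorem toFun_add (μ ν : POVM X H) (A : Set X) : (μ + ν).toFun A = μ.toFun A + ν.toFun A := rfl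

/-! ### Spectral measures are `C^*`-extreme. -/

/-- A projection valued measure is intertwined with each member of a `C^*`-convex combination
representing it by the corresponding coefficient. -/
theorem IsSpectral.mul_coeff_eq {μ : POVM X H} (hμ : μ.IsSpectral) {n : ℕ}
    {T : Fin n → (H →L[ℂ] H)} {ν : Fin n → POVM X H} (h : IsCStarConvexCombination μ T ν)
    (i : Fin n) {A : Set X} (hA : MeasurableSet A) :
    (ν i).toFun A * T i = T i * μ.toFun A := by
  have key : ∀ B : Set X, MeasurableSet B → (ν i).toFun B * T i * μ.toFun Bᶜ = 0 := by
    intro B hB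
    refine mul_mul_eq_zero_of_conj_le (e := μ.toFun B) ((ν i).nonneg hB) ?_ ?_
    · rw [h.sum_eq B hB]
      exact Finset.single_le_sum (f := fun j => star (T j) * (ν j).toFun B * T j)
        (fun j _ => star_left_conjugate_nonneg ((ν j).nonneg hB) _) (Finset.mem_univ i)
    · have h1 : μ.toFun B + μ.toFun Bᶜ = 1 := (μ.toFun_add_compl hB).trans hμ.2
      have h2 : μ.toFun Bᶜ = 1 - μ.toFun B := eq_sub_of_add_eq' h1
      rw [h2, mul_assoc, mul_sub, mul_one, (hμ.1 B hB).isIdempotentElem.eq, sub_self, mul_zero]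
  have h1 : μ.toFun Aᶜ = 1 - μ.toFun A :=
    eq_sub_of_add_eq' ((μ.toFun_add_compl hA).trans hμ.2)
  have h2 : (ν i).toFun Aᶜ = 1 - (ν i).toFun A :=
    eq_sub_of_add_eq' (((ν i).toFun_add_compl hA).trans (h.normalized i))
  have h3 := key A hA
  have h4 := key Aᶜ hA.compl
  rw [compl_compl, h2, sub_mul, sub_mul, one_mul, sub_eq_zero] at h4
  rw [h1, mul_sub, mul_one, sub_eq_zero] at h3
  rw [h3, h4]

theorem IsSpectral.isCStarExtreme {μ : POVM X H} (hμ : μ.IsSpectral) : μ.IsCStarExtreme := by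
  refine ⟨hμ.2, fun n T ν h i => ?_⟩
  obtain ⟨U, hU, hUab⟩ := exists_unitary_of_mul_eq_mul (h.isUnit i)
  exact ⟨U, hU, fun A hA => hUab _ _ (μ.isSelfAdjoint hA) ((ν i).isSelfAdjoint hA)
    (hμ.mul_coeff_eq h.toIsCStarConvexCombination i hA)⟩

/-! ### Commutative `C^*`-extreme points are spectral. -/

theorem conj_sqrt_inverse {μ : POVM X H} (hμ : IsUnit (μ.toFun Set.univ)) :
    (μ.conj (Ring.inverse (CFC.sqrt (μ.toFun Set.univ)))).IsNormalized ∧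
      ∀ A, star (CFC.sqrt (μ.toFun Set.univ)) *
        (μ.conj (Ring.inverse (CFC.sqrt (μ.toFun Set.univ)))).toFun A * CFC.sqrt (μ.toFun Set.univ) =
          μ.toFun A := by
  have hn := μ.nonneg MeasurableSet.univ
  set q := CFC.sqrt (μ.toFun Set.univ) with hq
  have hqs : IsSelfAdjoint q := IsSelfAdjoint.of_nonneg (CFC.sqrt_nonneg _)
  have hqq : q * q = μ.toFun Set.univ := CFC.sqrt_mul_sqrt_self _ hn
  have hu : IsUnit q := (CFC.isUnit_sqrt_iff _ hn).2 hμ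
  have hl : (Ring.inverse q) * q = 1 := Ring.inverse_mul_cancel _ hu
  have hr : q * (Ring.inverse q) = 1 := Ring.mul_inverse_cancel _ hu
  have hl' : star (Ring.inverse q) * q = 1 := by simpa [hqs.star_eq] using congrArg star hr
  have hr' : q * star (Ring.inverse q) = 1 := by simpa [hqs.star_eq] using congrArg star hl
  constructor
  · change star (Ring.inverse q) * μ.toFun Set.univ * (Ring.inverse q) = 1
    rw [← hqq, ← mul_assoc, hl', one_mul, hr]
  · intro A
    change star q * (star (Ring.inverse q) * μ.toFun A * (Ring.inverse q)) * q = _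
    rw [hqs.star_eq, mul_assoc (star (Ring.inverse q)), ← mul_assoc q, hr', one_mul, mul_assoc, hl, mul_one]

/-- Any additive splitting into parts of invertible total mass is a proper `C^*`-convex combination,
with coefficients `ρ(X)^{1/2}` and `σ(X)^{1/2}`. -/
theorem IsCStarExtreme.unitarilyEquivalent_conj {μ ρ σ : POVM X H} (h : μ.IsCStarExtreme)
    (hadd : ∀ A, MeasurableSet A → μ.toFun A = ρ.toFun A + σ.toFun A)
    (hρ : IsUnit (ρ.toFun Set.univ)) (hσ : IsUnit (σ.toFun Set.univ)) :
    UnitarilyEquivalent (ρ.conj (Ring.inverse (CFC.sqrt (ρ.toFun Set.univ)))) μ := by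
  refine h.2 2 ![CFC.sqrt (ρ.toFun Set.univ), CFC.sqrt (σ.toFun Set.univ)]
    ![ρ.conj (Ring.inverse (CFC.sqrt (ρ.toFun Set.univ))), σ.conj (Ring.inverse (CFC.sqrt (σ.toFun Set.univ)))]
    ⟨⟨?_, ?_, ?_⟩, ?_⟩ 0
  · simp [Fin.forall_fin_two, (conj_sqrt_inverse hρ).1, (conj_sqrt_inverse hσ).1]
  · have h1 := (conj_sqrt_inverse hρ).2 Set.univ
    have h2 := (conj_sqrt_inverse hσ).2 Set.univ
    rw [(conj_sqrt_inverse hρ).1, mul_one] at h1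
    rw [(conj_sqrt_inverse hσ).1, mul_one] at h2
    simp only [Fin.sum_univ_two, Matrix.cons_val_zero, Matrix.cons_val_one]
    rw [h1, h2, ← hadd _ MeasurableSet.univ]
    exact h.1
  · intro A hA
    simp only [Fin.sum_univ_two, Matrix.cons_val_zero, Matrix.cons_val_one]
    rw [(conj_sqrt_inverse hρ).2, (conj_sqrt_inverse hσ).2, hadd A hA]
  · simp [Fin.forall_fin_two, CFC.isUnit_sqrt_iff _ (ρ.nonneg MeasurableSet.univ),
      CFC.isUnit_sqrt_iff _ (σ.nonneg MeasurableSet.univ), hρ, hσ]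

/-- `A ↦ F μ(A ∩ B) F + (1 - F) μ(A ∩ Bᶜ) (1 - F)`. -/
noncomputable def pinch (μ : POVM X H) (B : Set X) (hB : MeasurableSet B) (F : H →L[ℂ] H) : POVM X H :=
  (μ.restrict B hB).conj F + (μ.restrict Bᶜ hB.compl).conj (1 - F)

theorem toFun_pinch (μ : POVM X H) {A B : Set X} (hB : MeasurableSet B) {F : H →L[ℂ] H}
    (hA : MeasurableSet A) (hF : IsStarProjection F)
    (hc : ∀ A, MeasurableSet A → Commute F (μ.toFun A)) :
    (μ.pinch B hB F).toFun A = μ.toFun (A ∩ B) * F + μ.toFun (A ∩ Bᶜ) * (1 - F) := by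
  have h1 := (hc _ (hA.inter hB)).eq
  have h2 := ((Commute.one_left _).sub_left (hc _ (hA.inter hB.compl))).eq
  have hG : IsStarProjection (1 - F) := hF.one_sub
  change star F * μ.toFun (A ∩ B) * F + star (1 - F) * μ.toFun (A ∩ Bᶜ) * (1 - F) = _
  rw [hF.isSelfAdjoint.star_eq, hG.isSelfAdjoint.star_eq, h1, h2, mul_assoc, mul_assoc,
    hF.isIdempotentElem.eq, hG.isIdempotentElem.eq]

theorem toFun_pinch_add_pinch (μ : POVM X H) {A B : Set X} (hB : MeasurableSet B)
    {F : H →L[ℂ] H} (hA : MeasurableSet A) (hF : IsStarProjection F)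
    (hc : ∀ A, MeasurableSet A → Commute F (μ.toFun A)) :
    (μ.pinch B hB F).toFun A + (μ.pinch B hB (1 - F)).toFun A = μ.toFun A := by
  have hc' : ∀ A, MeasurableSet A → Commute (1 - F) (μ.toFun A) := fun A hA =>
    (Commute.one_left _).sub_left (hc A hA)
  rw [μ.toFun_pinch hB hA hF hc, μ.toFun_pinch hB hA hF.one_sub hc',
    ← μ.toFun_restrict_add_restrict_compl hA hB]
  simp only [restrict]
  noncomm_ring

/-- The multiple of `μ` by a nonnegative real number. -/
noncomputable def smul (c : NNReal) (μ : POVM X H) : POVM X H where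
  toFun A := ((c : ℝ) : ℂ) • μ.toFun A
  isPositive A hA := (μ.isPositive A hA).smul_of_nonneg (by simp)
  isComplexMeasure h k := by
    obtain ⟨m, hm⟩ := μ.isComplexMeasure h k
    exact ⟨((c : ℝ) : ℂ) • m, fun A hA => by
      simp [hm A hA]⟩

/-- A commutative `C^*`-extreme point is a spectral measure: splitting off the part of `μ` given by
the spectral projection of `μ(B)` for the interval `(1/2, 1]` shows that `μ(B)` is unitarily
equivalent to that projection. -/
theorem IsCStarExtreme.isSpectral {μ : POVM X H} (h : μ.IsCStarExtreme)
    (hcomm : μ.IsCommutative) : μ.IsSpectral := by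
  refine ⟨fun B hB => ?_, h.1⟩
  have huniv : μ.toFun Set.univ = 1 := h.1
  set P := μ.toFun B with hP
  have hPc : μ.toFun Bᶜ = 1 - P := eq_sub_of_add_eq' ((μ.toFun_add_compl hB).trans h.1)
  have hPs : IsSelfAdjoint P := μ.isSelfAdjoint hB
  obtain ⟨F, hF, hTF, hTG, hFc⟩ := IsStarProjection.exists_mul_nonpos_of_isSelfAdjoint
    (T := P + P - 1) ((hPs.add hPs).sub (IsSelfAdjoint.one _))
  have hc : ∀ A, MeasurableSet A → Commute F (μ.toFun A) := fun A hA =>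
    hFc _ (μ.isSelfAdjoint hA)
      (((hcomm B A hB hA).add_left (hcomm B A hB hA)).sub_left (Commute.one_left _))
  have hG : IsStarProjection (1 - F) := hF.one_sub
  have hcG : ∀ A, MeasurableSet A → Commute (1 - F) (μ.toFun A) := fun A hA =>
    (Commute.one_left _).sub_left (hc A hA)
  set α := μ.pinch B hB (1 - F) with hα
  set β := μ.pinch B hB F with hβ
  have hαβ : ∀ A, MeasurableSet A → α.toFun A + β.toFun A = μ.toFun A := fun A hA => by
    rw [add_comm]
    exact μ.toFun_pinch_add_pinch hB hA hF hc
  have hαB : α.toFun B = P * (1 - F) := by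
    rw [hα, μ.toFun_pinch hB hB hG hcG, Set.inter_self, Set.inter_compl_self, toFun_empty,
      zero_mul, add_zero]
  have hαX : α.toFun Set.univ = P * (1 - F) + (1 - P) * F := by
    rw [hα, μ.toFun_pinch hB MeasurableSet.univ hG hcG, Set.univ_inter, Set.univ_inter, hPc,
      sub_sub_cancel]
  -- In fact `2α(X) = 1 + |2P - 1|`.
  have hα2 : (1 : H →L[ℂ] H) ≤ α.toFun Set.univ + α.toFun Set.univ := by
    have : α.toFun Set.univ + α.toFun Set.univ =
        1 + ((P + P - 1) * (1 - F) + -((P + P - 1) * F)) := by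
      rw [hαX]
      noncomm_ring
    rw [this]
    exact le_add_of_nonneg_right (add_nonneg hTG (neg_nonneg.2 hTF))
  -- `β(X)` may fail to be invertible (it is `0` when `P` is a projection), so half of `α` is moved
  -- over to it.
  set ρ := smul (1 / 2) α with hρ
  have hρA : ∀ A, ρ.toFun A = (1 / 2 : ℂ) • α.toFun A := fun A => by
    simp [hρ, smul]
  have hρρ : ∀ A, ρ.toFun A + ρ.toFun A = α.toFun A := fun A => by
    rw [hρA]
    module
  have hρu : IsUnit (ρ.toFun Set.univ) := by
    refine isUnit_of_one_le_nsmul 4 (hα2.trans_eq ?_)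
    rw [← hρρ]
    abel
  have hσu : IsUnit ((ρ + β).toFun Set.univ) := by
    refine isUnit_of_one_le_nsmul 2 ?_
    have : 2 • (ρ + β).toFun Set.univ = 1 + β.toFun Set.univ := by
      rw [← huniv, ← hαβ _ MeasurableSet.univ, ← hρρ, toFun_add]
      abel
    rw [this]
    exact le_add_of_nonneg_right (β.nonneg MeasurableSet.univ)
  obtain ⟨U, hU, hUA⟩ := h.unitarilyEquivalent_conj (ρ := ρ) (σ := ρ + β)
    (fun A hA => by rw [← hαβ A hA, toFun_add, ← add_assoc, hρρ]) hρu hσu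
  have hFP : Commute F P := hc B hB
  have hRF : Commute (ρ.toFun Set.univ) (1 - F) := by
    rw [hρA, hαX]
    refine Commute.smul_left ((Commute.one_right _).sub_right ?_) _
    exact (hFP.symm.mul_left ((Commute.one_left _).sub_left (Commute.refl _))).add_left
      (((Commute.one_left _).sub_left hFP.symm).mul_left (Commute.refl _))
  have hQF : Commute (CFC.sqrt (ρ.toFun Set.univ)) (1 - F) := by
    rw [CFC.sqrt_eq_cfc]
    exact hRF.cfc_nnreal _
  have hSF : Commute (Ring.inverse (CFC.sqrt (ρ.toFun Set.univ))) (1 - F) := by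
    obtain ⟨q, hq⟩ := (CFC.isUnit_sqrt_iff _ (ρ.nonneg MeasurableSet.univ)).2 hρu
    rw [← hq] at hQF ⊢
    rw [Ring.inverse_unit]
    exact hQF.units_inv_left
  have hρB : ρ.toFun B = ρ.toFun Set.univ * (1 - F) := by
    rw [hρA, hρA, hαB, hαX, smul_mul_assoc, add_mul, mul_assoc, mul_assoc,
      hG.isIdempotentElem.eq, mul_sub F, mul_one, hF.isIdempotentElem.eq, sub_self, mul_zero,
      add_zero]
  -- `ρ(X)^{-1/2}` commutes with `1 - F`, so that factor of `ρ(B)` can be pulled out of the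
  -- normalization.
  have hνB : (ρ.conj (Ring.inverse (CFC.sqrt (ρ.toFun Set.univ)))).toFun B = 1 - F := by
    have h1 : _ * _ * _ = _ := (conj_sqrt_inverse hρu).1
    change _ * ρ.toFun B * _ = _
    rw [hρB, ← mul_assoc, mul_assoc, ← hSF.eq, ← mul_assoc, h1, one_mul]
  have hPU : P = U * (1 - F) * star U := by
    rw [← hνB, hUA B hB, ← mul_assoc, ← mul_assoc, Unitary.mul_star_self_of_mem hU, one_mul,
      mul_assoc, Unitary.mul_star_self_of_mem hU, mul_one]
  refine ⟨?_, hPs⟩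
  rw [hPU, IsIdempotentElem]
  calc U * (1 - F) * star U * (U * (1 - F) * star U)
      = U * ((1 - F) * (star U * U) * (1 - F)) * star U := by simp only [mul_assoc]
    _ = U * (1 - F) * star U := by
      rw [Unitary.star_mul_self_of_mem hU, mul_one, hG.isIdempotentElem.eq]

end POVM

theorem mainTheorem4 {X : Type*} [MeasurableSpace X] {H : Type*} [NormedAddCommGroup H]
    [InnerProductSpace ℂ H] [CompleteSpace H] [TopologicalSpace.SeparableSpace H]
    (μ : POVM X H) (hnorm : μ.IsNormalized) (hcomm : μ.IsCommutative) :
    μ.IsCStarExtreme ↔ μ.IsSpectral :=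
  ⟨fun h => h.isSpectral hcomm, fun h => h.isCStarExtreme⟩
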